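/- Let $\mathbb{F}$ be an algebraically closed field of arbitrary characteristic and let $A$ be a finite-dimensional associative algebra over $\mathbb{F}$, not necessarily unital. Write $\operatorname{rad} A$ for the radical (largest nilpotent two-sided ideal) of $A$, and call $A$ $1$-perfect if it has no two-sided ideal of codimension $1$. For idempotents $e,f\in A$, the pair $(e,f)$ is called orthogonal if $ef=fe=0$, and strict if for each simple component $S$ of the semisimple algebra $A/\operatorname{rad} A$ the projections onto $S$ of the images of $e$ and $f$ in $A/\operatorname{rad} A$ are either both zero or both non-zero. Suppose that $A$ is $1$-perfect and let $A'\subseteq A$ be any subalgebra. Then for every strict orthogonal idempotent pair $(e',f')$ in $A'$ (strictness being taken with respect to $A'/\operatorname{rad} A'$) there is a strict orthogonal idempotent pair $(e,f)$ in $A$ such that $e'A'f'\subseteq eAf$. -/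

import Mathlib

/-- A (not necessarily unital) algebra `A` over `F` is `1`-perfect if it has no two-sided ideal
(as an algebra, so ideals are `F`-subspaces) of codimension one. -/
def IsOnePerfect (F A : Type*) [Field F] [NonUnitalRing A] [Module F A] : Prop :=
  ∀ I : Submodule F A, (∀ a : A, ∀ x ∈ I, a * x ∈ I ∧ x * a ∈ I) → Module.finrank F (A ⧸ I) ≠ 1

/-- A two-sided ideal `I` is nilpotent if `I ^ (n + 1) = 0` for some `n`, i.e. every product
`x * y₁ * ⋯ * yₙ` of `n + 1` elements of `I` vanishes. -/
def TwoSidedIdeal.IsNilpotentIdeal {A : Type*} [NonUnitalRing A] (I : TwoSidedIdeal A) : Prop :=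
  ∃ n : ℕ, ∀ x ∈ I, ∀ l : List A, l.length = n → (∀ y ∈ l, y ∈ I) →
    l.foldl (fun a b => a * b) x = 0

/-- The radical of a finite-dimensional algebra: the sum of its nilpotent two-sided ideals (which is
the largest nilpotent ideal). If `I` is a nilpotent two-sided ideal of the underlying ring of an
`F`-algebra, then so is its `F`-span, so it does not matter whether ideals are required to be
`F`-subspaces here. -/
noncomputable def algRadical (A : Type*) [NonUnitalRing A] : TwoSidedIdeal A :=
  sSup {I : TwoSidedIdeal A | I.IsNilpotentIdeal}

/-- The semisimple quotient `A / R`, where `R` is the radical of `A`. -/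
abbrev RadQuotient (A : Type*) [NonUnitalRing A] : Type _ :=
  (algRadical A).ringCon.Quotient

/-- The simple components of a semisimple algebra are its minimal non-zero two-sided ideals. -/
def IsSimpleComponent {B : Type*} [NonUnitalRing B] (S : TwoSidedIdeal B) : Prop :=
  IsAtom S

/-- The sum of all simple components other than `S`; a semisimple algebra is the direct sum of `S`
and this ideal. -/
noncomputable def otherComponents {B : Type*} [NonUnitalRing B] (S : TwoSidedIdeal B) :
    TwoSidedIdeal B :=
  sSup {T : TwoSidedIdeal B | IsSimpleComponent T ∧ T ≠ S}

/-- The projection of `x` on the simple component `S` (along the sum of the other simple components)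
is zero. -/
def ProjectionEqZero {B : Type*} [NonUnitalRing B] (S : TwoSidedIdeal B) (x : B) : Prop :=
  x ∈ otherComponents S

/-- `(e, f)` is a strict orthogonal idempotent pair in `A`: `e` and `f` are idempotents with
`e * f = f * e = 0` and, on each simple component of `A / R`, the projections of the images of
`e` and `f` are either both zero or both non-zero. -/
structure IsStrictOrthogonalIdempotentPair {A : Type*} [NonUnitalRing A] (e f : A) : Prop where
  idem_left : IsIdempotentElem e
  idem_right : IsIdempotentElem f
  mul_eq_zero : e * f = 0
  mul_eq_zero' : f * e = 0
  strict : ∀ S : TwoSidedIdeal (RadQuotient A), IsSimpleComponent S →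
    (ProjectionEqZero S (e : RadQuotient A) ↔ ProjectionEqZero S (f : RadQuotient A))

/-- The subset `eAf` of `A`. -/
def cornerSet {A : Type*} [NonUnitalRing A] (e f : A) : Set A :=
  Set.range fun a : A => e * a * f

/-! The pair `(e', f')` itself serves as `(e, f)`: the corner inclusion is then immediate, and the
point is that strictness passes from `A'` to `A`. For a simple component `S` of `A / rad A`, project
`A'` to `A / rad A` modulo the other components. If this map `ψ` kills one idempotent of the pair,
the image of `ker ψ` in `A' / rad A'` is an ideal containing that idempotent. By strictness it
contains the other one too (`mem_of_forall_projectionEqZero`), which is thus congruent to an element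
of `ker ψ` modulo `rad A'`. Its image under `ψ` is nilpotent and idempotent, hence zero. The ideal
theory of `A' / rad A'` comes from the unitization modulo its Jacobson radical, a semisimple ring.
-/

open scoped Pointwise

namespace TwoSidedIdeal

/-! ### Rings in which every two-sided ideal has an identity -/

section Identities

variable {B : Type*} [NonUnitalRing B]

/-- Every two-sided ideal of `B` is a ring with identity. -/
def HasIdentities (B : Type*) [NonUnitalRing B] : Prop :=
  ∀ I : TwoSidedIdeal B, ∃ u ∈ I, ∀ x ∈ I, u * x = x ∧ x * u = x

theorem identity_comm {I : TwoSidedIdeal B} {u : B} (hu : u ∈ I)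
    (h : ∀ x ∈ I, u * x = x ∧ x * u = x) (x : B) : u * x = x * u := by
  rw [← (h _ (I.mul_mem_right u x hu)).2, mul_assoc, (h _ (I.mul_mem_left x u hu)).1]

/-- The annihilator of a central element `u`. -/
def annihilatorOfCentral (u : B) (hu : ∀ x, u * x = x * u) : TwoSidedIdeal B :=
  .mk' {x | u * x = 0} (mul_zero u)
    (fun {x y} (hx : u * x = 0) (hy : u * y = 0) => show u * (x + y) = 0 by
      rw [mul_add, hx, hy, add_zero])
    (fun {x} (hx : u * x = 0) => show u * -x = 0 by rw [mul_neg, hx, neg_zero])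
    (fun {x y} (hy : u * y = 0) => show u * (x * y) = 0 by
      rw [← mul_assoc, hu, mul_assoc, hy, mul_zero])
    (fun {x y} (hx : u * x = 0) => show u * (x * y) = 0 by rw [← mul_assoc, hx, zero_mul])

theorem mem_annihilatorOfCentral {u : B} {hu : ∀ x, u * x = x * u} {x : B} :
    x ∈ annihilatorOfCentral u hu ↔ u * x = 0 :=
  mem_mk' _ _ _ _ _ _ _

/-- An element outside a two-sided ideal `J` lies outside some complement, containing `J`, of a
minimal two-sided ideal. -/
theorem HasIdentities.exists_isAtom [WellFoundedGT (TwoSidedIdeal B)] (hB : HasIdentities B)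
    {J : TwoSidedIdeal B} {e : B} (he : e ∉ J) :
    ∃ M S : TwoSidedIdeal B, J ≤ M ∧ e ∉ M ∧ IsAtom S ∧ (∀ x ∈ M, x ∈ S → x = 0) ∧
      ∀ x, ∃ m ∈ M, x - m ∈ S := by
  obtain ⟨M, ⟨hJM, heM⟩, hmax⟩ := wellFounded_gt.has_min
    {M : TwoSidedIdeal B | J ≤ M ∧ e ∉ M} ⟨J, le_rfl, he⟩
  obtain ⟨v, hv, hvM⟩ := hB M
  have hvc := identity_comm hv hvM
  have hS (x : B) : x ∈ annihilatorOfCentral v hvc ↔ v * x = 0 := mem_annihilatorOfCentral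
  have hsub (x : B) : x - v * x ∈ annihilatorOfCentral v hvc := by
    rw [hS, mul_sub, ← mul_assoc, (hvM v hv).1, sub_self]
  -- By maximality of `M`, adjoining `L` captures `e`; removing the `M`-part `v * e` leaves its part
  -- in `L`.
  have key (L : TwoSidedIdeal B) (hL : L ≤ annihilatorOfCentral v hvc) (hL0 : L ≠ ⊥) :
      e - v * e ∈ L := by
    have hlt : M < M ⊔ L := by
      refine lt_of_le_of_ne le_sup_left fun h => hL0 (eq_bot_iff.2 fun x hx => ?_)
      have hxM : x ∈ M := h ▸ mem_sup_right hx
      rw [mem_bot, ← (hvM x hxM).1]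
      exact (hS x).1 (hL hx)
    have he' : e ∈ M ⊔ L := by
      by_contra h
      exact hmax _ ⟨hJM.trans hlt.le, h⟩ hlt
    obtain ⟨m, hm, l, hl, rfl⟩ := mem_sup.1 he'
    rwa [mul_add, (hvM m hm).1, (hS l).1 (hL hl), add_zero, add_sub_cancel_left]
  have hd : e - v * e ≠ 0 := fun h => heM (sub_eq_zero.1 h ▸ M.mul_mem_right v e hv)
  refine ⟨M, annihilatorOfCentral v hvc, hJM, heM, ⟨fun h => hd ?_, fun L hL => ?_⟩,
    fun x hx hxS => ?_, fun x => ⟨v * x, M.mul_mem_right v x hv, hsub x⟩⟩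
  · rw [← mem_bot, ← h]
    exact hsub e
  · by_contra hL0
    obtain ⟨w, hw, hwL⟩ := hB L
    have hwc := identity_comm hw hwL
    refine hL.not_ge fun x hx => ?_
    by_contra hxL
    -- If `L` were proper, its complement in the annihilator of `v` would also contain `e - v * e`,
    -- on which `w` would act both as one and as zero.
    have hd' : e - v * e ∈ annihilatorOfCentral v hvc ⊓ annihilatorOfCentral w hwc := by
      refine key _ inf_le_left fun h => hxL ?_
      have : x - w * x ∈ annihilatorOfCentral v hvc ⊓ annihilatorOfCentral w hwc := by
        refine (mem_inf B).2 ⟨sub_mem _ hx (mul_mem_left _ _ _ hx), ?_⟩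
        rw [mem_annihilatorOfCentral, mul_sub, ← mul_assoc, (hwL w hw).1, sub_self]
      rw [h, mem_bot, sub_eq_zero] at this
      exact this ▸ L.mul_mem_right w x hw
    have h1 := (hwL _ (key L hL.le hL0)).1
    exact hd (h1 ▸ mem_annihilatorOfCentral.1 ((mem_inf B).1 hd').2)
  · rw [← (hvM x hx).1]
    exact (hS x).1 hxS

/-- If `e` projects to zero on each simple component where `f` does, then `e` lies in every two-sided
ideal containing `f`. -/
theorem HasIdentities.mem_of_forall_projectionEqZero [WellFoundedGT (TwoSidedIdeal B)]
    (hB : HasIdentities B) {e f : B}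
    (h : ∀ S : TwoSidedIdeal B, IsSimpleComponent S → ProjectionEqZero S f → ProjectionEqZero S e)
    {J : TwoSidedIdeal B} (hf : f ∈ J) : e ∈ J := by
  by_contra he
  obtain ⟨M, S, hJM, heM, hS, hdisj, hsum⟩ := hB.exists_isAtom he
  have hother : ∀ T : TwoSidedIdeal B, IsSimpleComponent T → T ≠ S → T ≤ M := by
    intro T hT hTS x hx
    obtain ⟨w, hw, hwT⟩ := hB T
    obtain ⟨m, hm, hs⟩ := hsum w
    have h1 : (w - m) * x ∈ T ⊓ S := (mem_inf B).2 ⟨T.mul_mem_left _ _ hx, S.mul_mem_right _ _ hs⟩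
    rw [(hT.disjoint_of_ne hS hTS).eq_bot, mem_bot, sub_mul, (hwT x hx).1, sub_eq_zero] at h1
    exact h1 ▸ M.mul_mem_right m x hm
  have hle : otherComponents S ≤ M := sSup_le fun T hT => hother T hT.1 hT.2
  refine heM (hle (h S hS ?_))
  -- A second separation, now of `f` from the other components, must single out `S` again; but `f ∈
  -- J ≤ M` is annihilated by the identity of `S`.
  by_contra hfO
  obtain ⟨M', S', hOM, hfM, hS', hdisj', hsum'⟩ := hB.exists_isAtom hfO
  obtain ⟨m, hm, hs⟩ := hsum' f
  by_cases hSS : S' = S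
  · subst hSS
    obtain ⟨w, hw, hwS⟩ := hB S'
    have h1 : w * f = 0 := hdisj _ (M.mul_mem_left _ _ (hJM hf)) (S'.mul_mem_right _ _ hw)
    have h2 : w * m = 0 := hdisj' _ (M'.mul_mem_left _ _ hm) (S'.mul_mem_right _ _ hw)
    have h3 := (hwS _ hs).1
    rw [mul_sub, h1, h2, sub_self, eq_comm, sub_eq_zero] at h3
    exact hfM (h3 ▸ hm)
  · have hle' : S' ≤ M' := (le_sSup (show S' ∈ {T : TwoSidedIdeal B | IsSimpleComponent T ∧ T ≠ S}
      from ⟨hS', hSS⟩)).trans hOM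
    exact hS'.1 (eq_bot_iff.2 fun x hx => (mem_bot B).2 (hdisj' x (hle' hx) hx))

end Identities

/-! ### Quotient maps and ideals of semisimple rings -/

/-- The quotient map by a two-sided ideal of a non-unital ring. -/
def quotientHom {R : Type*} [NonUnitalRing R] (I : TwoSidedIdeal R) :
    R →ₙ+* I.ringCon.Quotient where
  toFun x := x
  map_mul' _ _ := rfl
  map_zero' := rfl
  map_add' _ _ := rfl

theorem quotientHom_eq_zero {R : Type*} [NonUnitalRing R] {I : TwoSidedIdeal R} {x : R} :
    I.quotientHom x = 0 ↔ x ∈ I :=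
  (RingCon.eq _).trans (I.mem_iff x).symm

theorem quotientHom_surjective {R : Type*} [NonUnitalRing R] (I : TwoSidedIdeal R) :
    Function.Surjective I.quotientHom :=
  Quotient.mk_surjective

/-- Idempotent generators `r` as a left ideal and `l` as a right ideal give a right and a left
identity, which must agree. -/
theorem hasIdentity_of_isSemisimpleRing {Q : Type*} [Ring Q] [IsSemisimpleRing Q]
    (N : TwoSidedIdeal Q) : ∃ u ∈ N, ∀ x ∈ N, u * x = x ∧ x * u = x := by
  obtain ⟨r, hr, hN⟩ := IsSemisimpleRing.ideal_eq_span_idempotent N.asIdeal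
  obtain ⟨l, hl, hN'⟩ := IsSemisimpleRing.ideal_eq_span_idempotent N.asIdealOpposite
  have hrN : r ∈ N := mem_asIdeal.1 (hN ▸ Ideal.mem_span_singleton_self r)
  have hright (x : Q) (hx : x ∈ N) : x * r = x := by
    obtain ⟨y, rfl⟩ := Ideal.mem_span_singleton'.1 (hN ▸ mem_asIdeal.2 hx)
    rw [mul_assoc, hr]
  have hlN : MulOpposite.unop l ∈ N :=
    mem_asIdealOpposite.1 (hN' ▸ Ideal.mem_span_singleton_self l)
  have hleft (x : Q) (hx : x ∈ N) : MulOpposite.unop l * x = x := by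
    have hx' : MulOpposite.op x ∈ N.asIdealOpposite := mem_asIdealOpposite.2 hx
    obtain ⟨y, hy⟩ := Ideal.mem_span_singleton'.1 (hN' ▸ hx')
    apply MulOpposite.op_injective
    rw [MulOpposite.op_mul, MulOpposite.op_unop, ← hy, mul_assoc, hl]
  have hrl : MulOpposite.unop l = r := (hright _ hlN).symm.trans (hleft r hrN)
  exact ⟨r, hrN, fun x hx => ⟨hrl ▸ hleft x hx, hright x hx⟩⟩

end TwoSidedIdeal

/-! ### The radical through the unitization -/

section Radical

open TwoSidedIdeal

variable (F : Type*) [Field F] {A : Type*} [NonUnitalRing A] [Module F A] [IsScalarTower F A A]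
  [SMulCommClass F A A]

/-- The map from an algebra to the quotient of its unitization by the Jacobson radical. -/
noncomputable def toUnitizationQuotient :
    A →ₙ+* Unitization F A ⧸ Ring.jacobson (Unitization F A) :=
  (Ideal.Quotient.mk (Ring.jacobson (Unitization F A)) : _ →ₙ+* _).comp
    (Unitization.inrNonUnitalAlgHom F A : A →ₙ+* Unitization F A)

variable {F}

theorem toUnitizationQuotient_apply (a : A) :
    toUnitizationQuotient F a = Ideal.Quotient.mk (Ring.jacobson (Unitization F A)) a :=
  rfl

theorem toUnitizationQuotient_eq_zero {a : A} :
    toUnitizationQuotient F a = 0 ↔ (a : Unitization F A) ∈ Ring.jacobson (Unitization F A) :=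
  Ideal.Quotient.eq_zero_iff_mem

theorem mk_mul_toUnitizationQuotient (u : Unitization F A) (a : A) :
    Ideal.Quotient.mk _ u * toUnitizationQuotient F a =
      toUnitizationQuotient F (u.fst • a + u.snd * a) := by
  rw [toUnitizationQuotient_apply, toUnitizationQuotient_apply, ← map_mul]
  congr 1
  ext <;> simp

theorem toUnitizationQuotient_mul_mk (u : Unitization F A) (a : A) :
    toUnitizationQuotient F a * Ideal.Quotient.mk _ u =
      toUnitizationQuotient F (u.fst • a + a * u.snd) := by
  rw [toUnitizationQuotient_apply, toUnitizationQuotient_apply, ← map_mul]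
  congr 1
  ext <;> simp

/-- The `F`-span of `I` in the unitization is nilpotent and absorbs left multiplication, so every `u
* a + 1` is invertible. -/
theorem TwoSidedIdeal.IsNilpotentIdeal.toUnitizationQuotient_eq_zero {I : TwoSidedIdeal A}
    (hI : I.IsNilpotentIdeal) {a : A} (ha : a ∈ I) : toUnitizationQuotient F a = 0 := by
  obtain ⟨n, hn⟩ := hI
  let s : Set (Unitization F A) := {y | ∃ b ∈ I, (b : Unitization F A) = y}
  have hmul (u y : Unitization F A) (hy : y ∈ Submodule.span F s) :
      u * y ∈ Submodule.span F s := by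
    induction hy using Submodule.span_induction with
    | mem y hy =>
      obtain ⟨b, hb, rfl⟩ := hy
      have : u * (b : Unitization F A) =
          u.fst • (b : Unitization F A) + ((u.snd * b : A) : Unitization F A) := by
        ext <;> simp
      rw [this]
      exact Submodule.add_mem _ (Submodule.smul_mem _ _ (Submodule.subset_span ⟨b, hb, rfl⟩))
        (Submodule.subset_span ⟨_, I.mul_mem_left _ _ hb, rfl⟩)
    | zero => simp
    | add x y _ _ hx hy => rw [mul_add]; exact Submodule.add_mem _ hx hy
    | smul c x _ hx => rw [mul_smul_comm]; exact Submodule.smul_mem _ _ hx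
  have hprod (l : List A) (x : A) :
      ((l.foldl (fun a b => a * b) x : A) : Unitization F A) =
        x * (l.map (fun b : A => (b : Unitization F A))).prod := by
    induction l generalizing x with
    | nil => simp
    | cons b l ih => simp [ih, mul_assoc]
  have hpow : Submodule.span F s ^ (n + 1) = ⊥ := by
    rw [Submodule.span_pow, eq_bot_iff, Submodule.span_le]
    intro y hy
    have hlist : ∀ m : ℕ, ∀ y ∈ s ^ m, ∃ l : List A, l.length = m ∧ (∀ b ∈ l, b ∈ I) ∧
        (l.map (fun b : A => (b : Unitization F A))).prod = y := by
      intro m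
      induction m with
      | zero => intro y hy; exact ⟨[], rfl, by simp, by simpa [eq_comm] using hy⟩
      | succ m ih =>
        intro y hy
        rw [pow_succ'] at hy
        obtain ⟨_, ⟨b, hb, rfl⟩, z, hz, rfl⟩ := hy
        obtain ⟨l, hl, hlI, rfl⟩ := ih z hz
        exact ⟨b :: l, by simp [hl], by simpa [hb] using hlI, by simp⟩
    obtain ⟨l, hl, hlI, rfl⟩ := hlist _ y hy
    obtain _ | ⟨b, l⟩ := l
    · simp at hl
    · rw [List.map_cons, List.prod_cons, ← hprod,
        hn b (hlI b (by simp)) l (by simpa using hl) fun y hy => hlI y (by simp [hy])]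
      simp
  rw [_root_.toUnitizationQuotient_eq_zero, ← Ideal.jacobson_bot, Ideal.mem_jacobson_iff]
  intro u
  have hnil : IsNilpotent (u * (a : Unitization F A)) := by
    refine ⟨n + 1, ?_⟩
    have := Submodule.pow_mem_pow _ (hmul u a (Submodule.subset_span ⟨a, ha, rfl⟩)) (n + 1)
    rwa [hpow, Submodule.mem_bot] at this
  obtain ⟨z, hz⟩ := hnil.isUnit_add_one.exists_left_inv
  exact ⟨z, by rw [Ideal.mem_bot, mul_assoc, ← mul_add_one, hz, sub_self]⟩

theorem toUnitizationQuotient_eq_zero_of_mem_algRadical {a : A} (ha : a ∈ algRadical A) :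
    toUnitizationQuotient F a = 0 :=
  (mem_ker _).1 <| (sSup_le fun _ hI _ hx => (mem_ker _).2 (hI.toUnitizationQuotient_eq_zero hx) :
    algRadical A ≤ ker (toUnitizationQuotient F)) ha

variable (F)

/-- The image of `A` in the semisimple quotient of its unitization, as a two-sided ideal. -/
noncomputable def rangeToUnitizationQuotient (A : Type*) [NonUnitalRing A] [Module F A]
    [IsScalarTower F A A] [SMulCommClass F A A] :
    TwoSidedIdeal (Unitization F A ⧸ Ring.jacobson (Unitization F A)) :=
  .mk' (Set.range (toUnitizationQuotient F (A := A))) ⟨0, map_zero _⟩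
    (by rintro _ _ ⟨a, rfl⟩ ⟨b, rfl⟩; exact ⟨a + b, map_add _ _ _⟩)
    (by rintro _ ⟨a, rfl⟩; exact ⟨-a, map_neg _ _⟩)
    (by
      rintro x _ ⟨a, rfl⟩
      obtain ⟨u, rfl⟩ := Ideal.Quotient.mk_surjective x
      exact ⟨_, (mk_mul_toUnitizationQuotient u a).symm⟩)
    (by
      rintro _ x ⟨a, rfl⟩
      obtain ⟨u, rfl⟩ := Ideal.Quotient.mk_surjective x
      exact ⟨_, (toUnitizationQuotient_mul_mk u a).symm⟩)

theorem mem_rangeToUnitizationQuotient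
    {x : Unitization F A ⧸ Ring.jacobson (Unitization F A)} :
    x ∈ rangeToUnitizationQuotient F A ↔ ∃ a, toUnitizationQuotient F a = x :=
  mem_mk' _ _ _ _ _ _ _

variable [FiniteDimensional F A]

theorem isArtinianRing_unitization : IsArtinianRing (Unitization F A) := by
  have : Module.Finite F (Unitization F A) :=
    Module.Finite.equiv (Unitization.linearEquiv F F A).symm
  exact IsArtinianRing.of_finite F _

theorem isNilpotentIdeal_ker_toUnitizationQuotient :
    (ker (toUnitizationQuotient F (A := A))).IsNilpotentIdeal := by
  have := isArtinianRing_unitization F (A := A)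
  obtain ⟨n, hn⟩ := IsSemiprimaryRing.isNilpotent (R := Unitization F A)
  refine ⟨n, fun x hx l hl hlI => ?_⟩
  have key : ∀ l : List A, (∀ y ∈ l, y ∈ ker (toUnitizationQuotient F (A := A))) → ∀ (m : ℕ) (x : A),
      (x : Unitization F A) ∈ Ring.jacobson (Unitization F A) ^ m →
      ((l.foldl (fun a b => a * b) x : A) : Unitization F A) ∈
        Ring.jacobson (Unitization F A) ^ (m + l.length) := by
    intro l
    induction l with
    | nil => intro _ m x hx; simpa using hx
    | cons b l ih =>
      intro hl m x hx
      have hb := toUnitizationQuotient_eq_zero.1 ((mem_ker _).1 (hl b (by simp)))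
      have := ih (fun y hy => hl y (by simp [hy])) (m + 1) (x * b) (by
        rw [Unitization.inr_mul, Submodule.pow_succ]
        exact Ideal.mul_mem_mul hx hb)
      rwa [List.foldl_cons, List.length_cons, add_comm l.length, ← add_assoc]
  -- The `n` factors in `l` suffice, so `x` is only placed in the zeroth power.
  have h := key l hlI 0 x (by rw [Submodule.pow_zero, Ideal.one_eq_top]; trivial)
  rw [hl, zero_add, hn] at h
  exact Unitization.inr_injective (R := F) (by simpa using h)

theorem ker_toUnitizationQuotient : ker (toUnitizationQuotient F (A := A)) = algRadical A :=
  le_antisymm (le_sSup (isNilpotentIdeal_ker_toUnitizationQuotient F))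
    fun _ hx => (mem_ker _).2 (toUnitizationQuotient_eq_zero_of_mem_algRadical hx)

theorem isSemisimpleRing_unitization_quotient :
    IsSemisimpleRing (Unitization F A ⧸ Ring.jacobson (Unitization F A)) :=
  have := isArtinianRing_unitization F (A := A)
  IsSemiprimaryRing.isSemisimpleRing

/-- With `u` the identity of the image of `A`, `x` and `x * u` act alike on that image and `x * u`
lies in it. Hence even ideals not assumed closed under scalars absorb the unitization. -/
theorem exists_twoSidedIdeal_unitization_quotient (I : TwoSidedIdeal (RadQuotient A)) :
    ∃ N : TwoSidedIdeal (Unitization F A ⧸ Ring.jacobson (Unitization F A)),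
      ∀ x, x ∈ N ↔ ∃ a, (algRadical A).quotientHom a ∈ I ∧ toUnitizationQuotient F a = x := by
  have := isSemisimpleRing_unitization_quotient F (A := A)
  obtain ⟨u, hu, huN⟩ := hasIdentity_of_isSemisimpleRing (rangeToUnitizationQuotient F A)
  have hmem (a : A) : toUnitizationQuotient F a ∈ rangeToUnitizationQuotient F A :=
    (mem_rangeToUnitizationQuotient F).2 ⟨a, rfl⟩
  refine ⟨.mk' {x | ∃ a, (algRadical A).quotientHom a ∈ I ∧ toUnitizationQuotient F a = x}
    ?_ ?_ ?_ ?_ ?_, fun x => mem_mk' _ _ _ _ _ _ _⟩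
  · exact ⟨0, by rw [map_zero]; exact I.zero_mem, map_zero _⟩
  · rintro _ _ ⟨a, ha, rfl⟩ ⟨b, hb, rfl⟩
    exact ⟨a + b, by rw [map_add]; exact I.add_mem ha hb, map_add _ _ _⟩
  · rintro _ ⟨a, ha, rfl⟩
    exact ⟨-a, by rw [map_neg]; exact I.neg_mem ha, map_neg _ _⟩
  · rintro x _ ⟨a, ha, rfl⟩
    obtain ⟨b, hb⟩ := (mem_rangeToUnitizationQuotient F).1 (mul_mem_left _ x u hu)
    refine ⟨b * a, by rw [map_mul]; exact I.mul_mem_left _ _ ha, ?_⟩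
    rw [map_mul, hb, mul_assoc, (huN _ (hmem a)).1]
  · rintro _ x ⟨a, ha, rfl⟩
    obtain ⟨b, hb⟩ := (mem_rangeToUnitizationQuotient F).1 (mul_mem_right _ u x hu)
    refine ⟨a * b, by rw [map_mul]; exact I.mul_mem_right _ _ ha, ?_⟩
    rw [map_mul, hb, ← mul_assoc, (huN _ (hmem a)).2]

theorem quotientHom_eq_iff {a b : A} :
    (algRadical A).quotientHom a = (algRadical A).quotientHom b ↔
      toUnitizationQuotient F a = toUnitizationQuotient F b := by
  rw [← sub_eq_zero, ← map_sub, quotientHom_eq_zero, ← ker_toUnitizationQuotient F, mem_ker,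
    map_sub, sub_eq_zero]

end Radical

/-! ### Ideals of the quotient by the radical -/

open TwoSidedIdeal in
theorem isNilpotentIdeal_algRadical (F : Type*) [Field F] (A : Type*) [NonUnitalRing A]
    [Module F A] [IsScalarTower F A A] [SMulCommClass F A A] [FiniteDimensional F A] :
    (algRadical A).IsNilpotentIdeal :=
  ker_toUnitizationQuotient F (A := A) ▸ isNilpotentIdeal_ker_toUnitizationQuotient F

open TwoSidedIdeal in
theorem hasIdentities_radQuotient (F : Type*) [Field F] (A : Type*) [NonUnitalRing A]
    [Module F A] [IsScalarTower F A A] [SMulCommClass F A A] [FiniteDimensional F A] :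
    HasIdentities (RadQuotient A) := by
  intro I
  have := isSemisimpleRing_unitization_quotient F (A := A)
  obtain ⟨N, hN⟩ := exists_twoSidedIdeal_unitization_quotient F I
  obtain ⟨u, hu, huN⟩ := hasIdentity_of_isSemisimpleRing N
  obtain ⟨a, ha, rfl⟩ := (hN u).1 hu
  refine ⟨_, ha, fun x hx => ?_⟩
  obtain ⟨b, rfl⟩ := quotientHom_surjective _ x
  have h := huN _ ((hN _).2 ⟨b, hx, rfl⟩)
  rw [← map_mul, ← map_mul] at h ⊢
  exact ⟨(quotientHom_eq_iff F).2 h.1, (quotientHom_eq_iff F).2 h.2⟩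

-- Transport maps the ideals strictly monotonically to left ideals of a semisimple, hence
-- Noetherian, ring.
open TwoSidedIdeal in
theorem wellFoundedGT_twoSidedIdeal_radQuotient (F : Type*) [Field F] (A : Type*) [NonUnitalRing A]
    [Module F A] [IsScalarTower F A A] [SMulCommClass F A A] [FiniteDimensional F A] :
    WellFoundedGT (TwoSidedIdeal (RadQuotient A)) := by
  have := isSemisimpleRing_unitization_quotient F (A := A)
  choose N hN using exists_twoSidedIdeal_unitization_quotient F (A := A)
  have hmono : StrictMono fun I => (N I).asIdeal := by
    intro I J hIJ
    refine lt_of_le_of_ne (fun x hx => ?_) fun h => hIJ.not_ge fun x hx => ?_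
    · obtain ⟨a, ha, rfl⟩ := (hN I x).1 hx
      exact (hN J _).2 ⟨a, hIJ.le ha, rfl⟩
    · obtain ⟨a, rfl⟩ := quotientHom_surjective _ x
      have ha : toUnitizationQuotient F a ∈ (N J).asIdeal := (hN J _).2 ⟨a, hx, rfl⟩
      rw [← show (N I).asIdeal = (N J).asIdeal from h] at ha
      obtain ⟨b, hb, hab⟩ := (hN I _).1 ha
      rwa [← (quotientHom_eq_iff F).2 hab]
  exact hmono.wellFoundedGT

/-! ### Strictness passes to the whole algebra -/

open TwoSidedIdeal in
/-- A homomorphism killing `f` kills every idempotent `e` which is non-zero only on simple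
components where `f` is non-zero. -/
theorem map_eq_zero_of_projectionEqZero (F : Type*) [Field F] {A : Type*} [NonUnitalRing A]
    [Module F A] [IsScalarTower F A A] [SMulCommClass F A A] [FiniteDimensional F A]
    {C : Type*} [NonUnitalRing C] (ψ : A →ₙ+* C) {e f : A}
    (he : IsIdempotentElem e) (h : ∀ S : TwoSidedIdeal (RadQuotient A), IsSimpleComponent S →
      ProjectionEqZero S (f : RadQuotient A) → ProjectionEqZero S (e : RadQuotient A))
    (hf : ψ f = 0) : ψ e = 0 := by
  have := wellFoundedGT_twoSidedIdeal_radQuotient F A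
  let q := (algRadical A).quotientHom
  let J : TwoSidedIdeal (RadQuotient A) := .mk' {x | ∃ a, ψ a = 0 ∧ q a = x}
    ⟨0, map_zero _, map_zero _⟩
    (by
      rintro _ _ ⟨a, ha, rfl⟩ ⟨b, hb, rfl⟩
      exact ⟨a + b, by rw [map_add, ha, hb, add_zero], map_add _ _ _⟩)
    (by rintro _ ⟨a, ha, rfl⟩; exact ⟨-a, by rw [map_neg, ha, neg_zero], map_neg _ _⟩)
    (by
      rintro x _ ⟨a, ha, rfl⟩
      obtain ⟨b, rfl⟩ := quotientHom_surjective _ x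
      exact ⟨b * a, by rw [map_mul, ha, mul_zero], map_mul _ _ _⟩)
    (by
      rintro _ x ⟨a, ha, rfl⟩
      obtain ⟨b, rfl⟩ := quotientHom_surjective _ x
      exact ⟨a * b, by rw [map_mul, ha, zero_mul], map_mul _ _ _⟩)
  have heJ : (e : RadQuotient A) ∈ J :=
    (hasIdentities_radQuotient F A).mem_of_forall_projectionEqZero h
      ((mem_mk' _ _ _ _ _ _ _).2 ⟨f, hf, rfl⟩)
  obtain ⟨a, ha, hae⟩ := (mem_mk' _ _ _ _ _ _ _).1 heJ
  have hr : e - a ∈ algRadical A := by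
    rw [← quotientHom_eq_zero, map_sub, sub_eq_zero]
    exact hae.symm
  obtain ⟨n, hn⟩ := isNilpotentIdeal_algRadical F A
  have h0 := hn _ hr (List.replicate n (e - a)) List.length_replicate
    fun y hy => List.eq_of_mem_replicate hy ▸ hr
  -- `ψ e` is the image of the radical element `e - a`; idempotence makes all its powers equal, so
  -- nilpotence kills it.
  have hψ : ψ (e - a) = ψ e := by rw [map_sub, ha, sub_zero]
  have hfold (m : ℕ) (x : A) (hx : ψ x = ψ e) :
      ψ ((List.replicate m (e - a)).foldl (fun a b => a * b) x) = ψ e := by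
    induction m generalizing x with
    | zero => exact hx
    | succ m ih =>
      exact ih _ (by rw [map_mul, hx, hψ, ← map_mul, he])
  rw [← hfold n _ hψ, h0, map_zero]

/-- An idempotent pair that is strict orthogonal in a subalgebra is so in the whole algebra. -/
theorem IsStrictOrthogonalIdempotentPair.of_subalgebra {F : Type*} [Field F]
    {A : Type*} [NonUnitalRing A] [Module F A] [IsScalarTower F A A] [SMulCommClass F A A]
    [FiniteDimensional F A] {A' : NonUnitalSubalgebra F A} {e f : A'}
    (h : IsStrictOrthogonalIdempotentPair e f) :
    IsStrictOrthogonalIdempotentPair (e : A) (f : A) where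
  idem_left := congrArg Subtype.val h.idem_left
  idem_right := congrArg Subtype.val h.idem_right
  mul_eq_zero := congrArg Subtype.val h.mul_eq_zero
  mul_eq_zero' := congrArg Subtype.val h.mul_eq_zero'
  strict S _ := by
    have : FiniteDimensional F A' :=
      inferInstanceAs (FiniteDimensional F A'.toSubmodule)
    let ψ : A' →ₙ+* (otherComponents S).ringCon.Quotient :=
      (otherComponents S).quotientHom.comp
        ((algRadical A).quotientHom.comp (NonUnitalSubalgebraClass.subtype A' : A' →ₙ+* A))
    have hψ (a : A') : ψ a = 0 ↔ ProjectionEqZero S ((a : A) : RadQuotient A) :=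
      TwoSidedIdeal.quotientHom_eq_zero
    rw [← hψ, ← hψ]
    exact ⟨map_eq_zero_of_projectionEqZero F ψ h.idem_right fun T hT => (h.strict T hT).1,
      map_eq_zero_of_projectionEqZero F ψ h.idem_left fun T hT => (h.strict T hT).2⟩

theorem corollary1p3 {F : Type*} [Field F] [IsAlgClosed F]
    {A : Type*} [NonUnitalRing A] [Module F A] [IsScalarTower F A A] [SMulCommClass F A A]
    [FiniteDimensional F A] (hA : IsOnePerfect F A)
    (A' : NonUnitalSubalgebra F A)
    (e' f' : A') (h : IsStrictOrthogonalIdempotentPair e' f') :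
    ∃ e f : A, IsStrictOrthogonalIdempotentPair e f ∧
      (fun x : A' => (x : A)) '' cornerSet e' f' ⊆ cornerSet e f := by
  refine ⟨e', f', h.of_subalgebra, ?_⟩
  rintro _ ⟨_, ⟨a, rfl⟩, rfl⟩
  exact ⟨a, rfl⟩
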